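/- Let $\mathbf{CFA}$ be the category of CF-approximation spaces and CF-approximable relations, and let $\mathbf{DOM}$ be the category of domains and Scott continuous functions, both defined below. Then the categories $\mathbf{CFA}$ and $\mathbf{DOM}$ are equivalent. Domains. A subset of a poset is directed if it is nonempty and any two of its elements have an upper bound in it. A poset $D$ is directed-complete if each of its directed subsets has a least upper bound. For $x, y \in D$ write $x \ll y$ if for every directed $S \subseteq D$ that has a least upper bound, $y \sqsubseteq \bigsqcup S$ implies $x \sqsubseteq u$ for some $u \in S$. A basis of $D$ is a subset $B \subseteq D$ such that for every $x \in D$ the set $\{u \in B \mid u \ll x\}$ contains a directed subset with least upper bound $x$. A domain is a directed-complete partial order that has a basis; a least element is not required. A function $f$ between domains is Scott continuous if $\bigsqcup f[S] = f(\bigsqcup S)$ for every directed set $S$. Composition in $\mathbf{DOM}$ is the usual composition of functions. CF-approximation spaces. Let $\Theta$ be a binary relation on a set $U$. For $X \subseteq U$ put $\overline{\Theta}(X) = \{x \in U \mid x \mathrel{\Theta} y \text{ for some } y \in X\}$. A CF-approximation space is a triple $(U, \Theta, \mathfrak{F})$ with $U$ a set, $\Theta$ a transitive relation on $U$, and $\mathfrak{F}$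 a family of finite subsets of $U$, such that for every $F \in \mathfrak{F}$ and every finite $K \subseteq \overline{\Theta}(F)$ there is some $G \in \mathfrak{F}$ with $K \subseteq \overline{\Theta}(G)$ and $G \subseteq \overline{\Theta}(F)$. A CF-approximable relation from $(U, \Theta, \mathfrak{F})$ to $(U', \Theta', \mathfrak{F}')$ is a relation $\Delta \subseteq \mathfrak{F} \times \mathfrak{F}'$ such that for all $F, F' \in \mathfrak{F}$ and $G, G' \in \mathfrak{F}'$: 1. there is $\widehat{G} \in \mathfrak{F}'$ with $F \mathrel{\Delta} \widehat{G}$; 2. if $F \subseteq \overline{\Theta}(F')$ and $F \mathrel{\Delta} G$, then $F' \mathrel{\Delta} G$; 3. if $F \mathrel{\Delta} G$ and $G' \subseteq \overline{\Theta'}(G)$, then $F \mathrel{\Delta} G'$; 4. if $F \mathrel{\Delta} G$, then there are $\widehat{F} \in \mathfrak{F}$ and $\widehat{G} \in \mathfrak{F}'$ with $\widehat{F} \subseteq \overline{\Theta}(F)$, $G \subseteq \overline{\Theta'}(\widehat{G})$ and $\widehat{F} \mathrel{\Delta} \widehat{G}$; 5. if $F \mathrel{\Delta} G$ and $F \mathrel{\Delta}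 G'$, then there is $\widehat{G} \in \mathfrak{F}'$ with $G \cup G' \subseteq \overline{\Theta'}(\widehat{G})$ and $F \mathrel{\Delta} \widehat{G}$. The identity morphism of $(U, \Theta, \mathfrak{F})$ in $\mathbf{CFA}$ relates $F$ to $G$ if and only if $G \subseteq \overline{\Theta}(F)$, and morphisms are composed as relations: $F \mathrel{(\Delta \circ \Omega)} G$ if and only if $F \mathrel{\Delta} E$ and $E \mathrel{\Omega} G$ for some $E$. -/

import Mathlib

open CategoryTheory

universe u

/-! ### Domains and Scott continuous functions -/

namespace DomainTheory

section Order

variable {α : Type u} [PartialOrder α]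

/-- A subset of a poset is directed if it is nonempty and every pair of its elements has an upper
bound in it. -/
def IsDirectedSet (S : Set α) : Prop :=
  S.Nonempty ∧ DirectedOn (· ≤ ·) S

/-- The approximation (way-below) relation `x ≪ y` of a poset. -/
def Approximates (x y : α) : Prop :=
  ∀ (S : Set α) (s : α), IsDirectedSet S → IsLUB S s → y ≤ s → ∃ a ∈ S, x ≤ a

/-- `B` is a basis of the poset: for each `x`, the set of all elements of `B` that approximate `x`
contains a directed subset with least upper bound `x`. -/
def IsBasis (B : Set α) : Prop :=
  ∀ x : α, ∃ S : Set α, S ⊆ {b | b ∈ B ∧ Approximates b x} ∧ IsDirectedSet S ∧ IsLUB S x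

end Order

/-- A poset is directed-complete if each of its directed subsets has a least upper bound. -/
def IsDirectedComplete (α : Type u) [PartialOrder α] : Prop :=
  ∀ S : Set α, IsDirectedSet S → ∃ s : α, IsLUB S s

/-- A domain: a directed-complete partial order that has a basis. It need not have a least
element, and no particular basis is part of the structure. -/
structure Dom : Type (u + 1) where
  carrier : Type u
  [order : PartialOrder carrier]
  directedComplete : IsDirectedComplete carrier
  exists_basis : ∃ B : Set carrier, IsBasis B

attribute [instance] Dom.order

/-- A Scott continuous function between domains: the image of each directed set with least upper
bound `s` has least upper bound `f s`. -/
@[ext]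
structure Dom.Hom (D E : Dom.{u}) : Type u where
  toFun : D.carrier → E.carrier
  scottContinuous : ScottContinuous toFun

/-- The category **DOM** of domains and Scott continuous functions. -/
instance : Category.{u} Dom.{u} where
  Hom D E := Dom.Hom D E
  id D := ⟨id, ScottContinuous.id⟩
  comp f g := ⟨g.toFun ∘ f.toFun, f.scottContinuous.comp g.scottContinuous⟩

end DomainTheory

/-! ### CF-approximation spaces and CF-approximable relations -/

namespace RoughSet

/-- The upper approximation operator of a generalized approximation space `(U, Θ)`:
the set of all `x` such that `x Θ y` for some `y ∈ X`. -/
def upperApprox {U : Type u} (Θ : U → U → Prop) (X : Set U) : Set U :=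
  {x | ({y | Θ x y} ∩ X).Nonempty}

/-- A generalized approximation space with consistent family of finite subsets
(CF-approximation space): a set with a transitive relation `Θ` and a family of finite subsets
that satisfies condition (CF). -/
structure CFApproxSpace : Type (u + 1) where
  carrier : Type u
  rel : carrier → carrier → Prop
  rel_trans : ∀ x y z, rel x y → rel y z → rel x z
  family : Set (Finset carrier)
  cf : ∀ F ∈ family, ∀ K : Finset carrier, (K : Set carrier) ⊆ upperApprox rel F →
    ∃ G ∈ family, (K : Set carrier) ⊆ upperApprox rel G ∧
      (G : Set carrier) ⊆ upperApprox rel F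

namespace CFApproxSpace

/-- The upper approximation of a finite set in a CF-approximation space. -/
def upper (A : CFApproxSpace.{u}) (F : Finset A.carrier) : Set A.carrier :=
  upperApprox A.rel F

theorem upper_subset (A : CFApproxSpace.{u}) {F G : Finset A.carrier}
    (h : (F : Set A.carrier) ⊆ A.upper G) : A.upper F ⊆ A.upper G := by
  rintro x ⟨y, hxy, hy⟩
  obtain ⟨z, hyz, hz⟩ := h hy
  exact ⟨z, A.rel_trans x y z hxy hyz, hz⟩

/-- A CF-approximable relation from `A` to `B`: a relation between the two families of finite sets
with the five listed properties. -/
@[ext]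
structure Hom (A B : CFApproxSpace.{u}) : Type u where
  rel : A.family → B.family → Prop
  total : ∀ F : A.family, ∃ G : B.family, rel F G
  mono_left : ∀ (F F' : A.family) (G : B.family),
    (F.1 : Set A.carrier) ⊆ A.upper F'.1 → rel F G → rel F' G
  mono_right : ∀ (F : A.family) (G G' : B.family),
    rel F G → (G'.1 : Set B.carrier) ⊆ B.upper G.1 → rel F G'
  interpolate : ∀ (F : A.family) (G : B.family), rel F G →
    ∃ (F₁ : A.family) (G₁ : B.family), (F₁.1 : Set A.carrier) ⊆ A.upper F.1 ∧
      (G.1 : Set B.carrier) ⊆ B.upper G₁.1 ∧ rel F₁ G₁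
  directed : ∀ (F : A.family) (G G' : B.family), rel F G → rel F G' → ∃ G₁ : B.family,
    (G.1 : Set B.carrier) ∪ (G'.1 : Set B.carrier) ⊆ B.upper G₁.1 ∧ rel F G₁

/-- The identity relation: `F` is related to `G` iff `G` is contained in the upper approximation
of `F`. -/
def Hom.id (A : CFApproxSpace.{u}) : Hom A A where
  rel F G := (G.1 : Set A.carrier) ⊆ A.upper F.1
  total F := by
    obtain ⟨G, hG, -, h⟩ := A.cf F.1 F.2 ∅ (by simp)
    exact ⟨⟨G, hG⟩, h⟩
  mono_left F F' G h hG := hG.trans (A.upper_subset h)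
  mono_right F G G' h hG := hG.trans (A.upper_subset h)
  interpolate F G h := by
    obtain ⟨G₁, hG₁, h₁, h₂⟩ := A.cf F.1 F.2 G.1 h
    obtain ⟨F₁, hF₁, h₃, h₄⟩ := A.cf F.1 F.2 G₁ h₂
    exact ⟨⟨F₁, hF₁⟩, ⟨G₁, hG₁⟩, h₄, h₁, h₃⟩
  directed F G G' h h' := by
    classical
    obtain ⟨G₁, hG₁, h₁, h₂⟩ := A.cf F.1 F.2 (G.1 ∪ G'.1) (by
      rw [Finset.coe_union]; exact Set.union_subset h h')
    rw [Finset.coe_union] at h₁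
    exact ⟨⟨G₁, hG₁⟩, h₁, h₂⟩

/-- Relational composition: `F` is related to `G` iff `F Δ E` and `E Ω G` for some `E`. -/
def Hom.comp {A B C : CFApproxSpace.{u}} (Δ : Hom A B) (Ω : Hom B C) : Hom A C where
  rel F G := ∃ E, Δ.rel F E ∧ Ω.rel E G
  total F := by
    obtain ⟨E, hE⟩ := Δ.total F
    obtain ⟨G, hG⟩ := Ω.total E
    exact ⟨G, E, hE, hG⟩
  mono_left := by
    rintro F F' G h ⟨E, h₁, h₂⟩
    exact ⟨E, Δ.mono_left _ _ _ h h₁, h₂⟩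
  mono_right := by
    rintro F G G' ⟨E, h₁, h₂⟩ h
    exact ⟨E, h₁, Ω.mono_right _ _ _ h₂ h⟩
  interpolate := by
    rintro F G ⟨E, h₁, h₂⟩
    obtain ⟨F₁, E₁, hF, hE, h₃⟩ := Δ.interpolate _ _ h₁
    obtain ⟨E₂, G₁, hE₂, hG, h₄⟩ := Ω.interpolate _ _ (Ω.mono_left _ _ _ hE h₂)
    exact ⟨F₁, G₁, hF, hG, E₁, h₃, Ω.mono_left _ _ _ hE₂ h₄⟩
  directed := by
    rintro F G G' ⟨E, h₁, h₂⟩ ⟨E', h₁', h₂'⟩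
    obtain ⟨E₁, hE, h₃⟩ := Δ.directed _ _ _ h₁ h₁'
    obtain ⟨G₁, hG, h₄⟩ := Ω.directed E₁ G G'
      (Ω.mono_left _ _ _ (Set.subset_union_left.trans hE) h₂)
      (Ω.mono_left _ _ _ (Set.subset_union_right.trans hE) h₂')
    exact ⟨G₁, hG, E₁, h₃, h₄⟩

theorem Hom.id_comp {A B : CFApproxSpace.{u}} (Δ : Hom A B) : (Hom.id A).comp Δ = Δ := by
  ext F G
  constructor
  · rintro ⟨E, h₁, h₂⟩
    exact Δ.mono_left _ _ _ h₁ h₂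
  · intro h
    obtain ⟨F₁, G₁, hF, hG, h₁⟩ := Δ.interpolate _ _ h
    exact ⟨F₁, hF, Δ.mono_right _ _ _ h₁ hG⟩

theorem Hom.comp_id {A B : CFApproxSpace.{u}} (Δ : Hom A B) : Δ.comp (Hom.id B) = Δ := by
  ext F G
  constructor
  · rintro ⟨E, h₁, h₂⟩
    exact Δ.mono_right _ _ _ h₁ h₂
  · intro h
    obtain ⟨F₁, G₁, hF, hG, h₁⟩ := Δ.interpolate _ _ h
    exact ⟨G₁, Δ.mono_left _ _ _ hF h₁, hG⟩

theorem Hom.assoc {A B C D : CFApproxSpace.{u}} (Δ : Hom A B) (Ω : Hom B C) (Λ : Hom C D) :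
    (Δ.comp Ω).comp Λ = Δ.comp (Ω.comp Λ) := by
  ext F G
  constructor
  · rintro ⟨E, ⟨E', h₁, h₂⟩, h₃⟩
    exact ⟨E', h₁, E, h₂, h₃⟩
  · rintro ⟨E, h₁, E', h₂, h₃⟩
    exact ⟨E', ⟨E, h₁, h₂⟩, h₃⟩

end CFApproxSpace

/-- The category **CFA** of CF-approximation spaces and CF-approximable relations. -/
instance : Category.{u} CFApproxSpace.{u} where
  Hom A B := CFApproxSpace.Hom A B
  id A := CFApproxSpace.Hom.id A
  comp Δ Ω := Δ.comp Ω
  id_comp Δ := Δ.id_comp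
  comp_id Δ := Δ.comp_id
  assoc Δ Ω Λ := Δ.assoc Ω Λ

end RoughSet

/-! Under `Below`, the family of a CF-approximation space behaves like an abstract basis:
transitivity of the relation makes `Below` transitive, and (CF) makes the sets below a given one
directed. Its rounded ideals form a domain in which directed suprema are unions and the principal
ideals are a basis (`isBasis_range_principal`).

A Scott continuous map is determined by its values on principal ideals (`mem_apply_iff`), so `f`
corresponds to the relation `G ∈ f (principal F)`. This makes the rounded ideal functor full and
faithful. It is essentially surjective because a domain, taken with its approximation relation and
all singletons, satisfies (CF) by interpolation, and its rounded ideals are the sets of points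
approximating some `x` (`exists_principal_single_eq`). -/

namespace DomainTheory

/-! ### The approximation relation in a poset with a basis. -/

section Order

variable {α : Type u} [PartialOrder α] {B : Set α} {a b x y z : α}

theorem Approximates.le (h : Approximates x y) : x ≤ y := by
  obtain ⟨_, rfl, hxy⟩ := h {y} y ⟨⟨y, rfl⟩, directedOn_singleton _⟩ isLUB_singleton le_rfl
  exact hxy

theorem Approximates.mono (hab : a ≤ x) (h : Approximates x y) (hyb : y ≤ b) :
    Approximates a b := by
  intro S s hS hs hb
  obtain ⟨c, hc, hxc⟩ := h S s hS hs (hyb.trans hb)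
  exact ⟨c, hc, hab.trans hxc⟩

theorem IsBasis.isDirectedSet_approximates (hB : IsBasis B) (x : α) :
    IsDirectedSet {y | Approximates y x} := by
  obtain ⟨S, hSB, hS, hx⟩ := hB x
  refine ⟨hS.1.mono fun s hs => (hSB hs).2, fun a ha b hb => ?_⟩
  obtain ⟨s, hs, has⟩ := ha S x hS hx le_rfl
  obtain ⟨t, ht, hbt⟩ := hb S x hS hx le_rfl
  obtain ⟨r, hr, hsr, htr⟩ := hS.2 s hs t ht
  exact ⟨r, (hSB hr).2, has.trans hsr, hbt.trans htr⟩

theorem IsBasis.isLUB_approximates (hB : IsBasis B) (x : α) :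
    IsLUB {y | Approximates y x} x := by
  obtain ⟨S, hSB, -, hx⟩ := hB x
  exact ⟨fun y hy => Approximates.le hy, fun u hu => hx.2 fun s hs => hu (hSB hs).2⟩

/-- The interpolation property of the approximation relation. -/
theorem IsBasis.exists_between (hB : IsBasis B) (h : Approximates x y) :
    ∃ z, Approximates x z ∧ Approximates z y := by
  have hT : IsDirectedSet {t | ∃ z, Approximates t z ∧ Approximates z y} := by
    constructor
    · obtain ⟨z, hz⟩ := (hB.isDirectedSet_approximates y).1
      obtain ⟨t, ht⟩ := (hB.isDirectedSet_approximates z).1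
      exact ⟨t, z, ht, hz⟩
    · rintro a ⟨z, haz, hz⟩ b ⟨w, hbw, hw⟩
      obtain ⟨v, hv, hzv, hwv⟩ := (hB.isDirectedSet_approximates y).2 z hz w hw
      obtain ⟨c, hc, hac, hbc⟩ := (hB.isDirectedSet_approximates v).2
        a (haz.mono le_rfl hzv) b (hbw.mono le_rfl hwv)
      exact ⟨c, ⟨v, hc, hv⟩, hac, hbc⟩
  have hy : IsLUB {t | ∃ z, Approximates t z ∧ Approximates z y} y := by
    refine ⟨?_, fun u hu => (hB.isLUB_approximates y).2 fun z hz =>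
      (hB.isLUB_approximates z).2 fun t ht => hu ⟨z, ht, hz⟩⟩
    rintro t ⟨z, htz, hzy⟩
    exact htz.le.trans hzy.le
  -- The points two approximation steps below `y` are directed with supremum `y`, so `x ≪ y` puts
  -- `x` under one of them.
  obtain ⟨t, ⟨z, htz, hzy⟩, hxt⟩ := h _ y hT hy le_rfl
  exact ⟨z, htz.mono hxt le_rfl, hzy⟩

theorem IsDirectedSet.exists_finset_le {S : Set α} (hS : IsDirectedSet S) (K : Finset α)
    (hK : (K : Set α) ⊆ S) : ∃ s ∈ S, ∀ k ∈ K, k ≤ s := by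
  classical
  induction K using Finset.induction_on with
  | empty => exact hS.1.imp fun s hs => ⟨hs, by simp⟩
  | insert a K _ ih =>
    rw [Finset.coe_insert, Set.insert_subset_iff] at hK
    obtain ⟨s, hs, hKs⟩ := ih hK.2
    obtain ⟨t, ht, hat, hst⟩ := hS.2 a hK.1 s hs
    refine ⟨t, ht, fun k hk => ?_⟩
    obtain rfl | hk := Finset.mem_insert.1 hk
    exacts [hat, (hKs k hk).trans hst]

end Order

theorem _root_.OrderIso.scottContinuous {α β : Type*} [PartialOrder α] [PartialOrder β]
    (e : α ≃o β) : ScottContinuous e :=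
  fun _ _ _ _ ha => e.isLUB_image'.2 ha

/-- Order isomorphic domains are isomorphic in **DOM**. -/
def Dom.isoOfOrderIso {D E : Dom.{u}} (e : D.carrier ≃o E.carrier) : D ≅ E where
  hom := (⟨e, e.scottContinuous⟩ : Dom.Hom D E)
  inv := (⟨e.symm, e.symm.scottContinuous⟩ : Dom.Hom E D)
  hom_inv_id := Dom.Hom.ext (funext e.symm_apply_apply)
  inv_hom_id := Dom.Hom.ext (funext e.apply_symm_apply)

end DomainTheory

/-! ### Rounded ideals and the maps between them. -/

namespace RoughSet

namespace CFApproxSpace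

open DomainTheory

/-- The transitive relation between members of the family given by inclusion in the upper
approximation. -/
def Below (A : CFApproxSpace.{u}) (G F : A.family) : Prop :=
  (G.1 : Set A.carrier) ⊆ A.upper F.1

variable {A B C : CFApproxSpace.{u}}

theorem Below.trans {F G H : A.family} (h : A.Below F G) (h' : A.Below G H) : A.Below F H :=
  Set.Subset.trans h (A.upper_subset h')

theorem exists_below (F : A.family) : ∃ G, A.Below G F :=
  (Hom.id A).total F

theorem exists_below_of_below {F G G' : A.family} (h : A.Below G F) (h' : A.Below G' F) :
    ∃ H, A.Below G H ∧ A.Below G' H ∧ A.Below H F := by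
  obtain ⟨H, hH, hHF⟩ := (Hom.id A).directed F G G' h h'
  exact ⟨H, Set.subset_union_left.trans hH, Set.subset_union_right.trans hH, hHF⟩

/-- A rounded ideal of the family of a CF-approximation space, ordered by `Below`. -/
structure RoundedIdeal (A : CFApproxSpace.{u}) : Type u where
  carrier : Set A.family
  nonempty : carrier.Nonempty
  lower : ∀ {F G : A.family}, F ∈ carrier → A.Below G F → G ∈ carrier
  directed : ∀ {F G : A.family}, F ∈ carrier → G ∈ carrier →
    ∃ H ∈ carrier, A.Below F H ∧ A.Below G H

namespace RoundedIdeal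

instance : SetLike A.RoundedIdeal A.family where
  coe := carrier
  coe_injective := by rintro ⟨I, _, _, _⟩ ⟨J, _, _, _⟩ rfl; rfl

instance : PartialOrder A.RoundedIdeal := PartialOrder.ofSetLike A.RoundedIdeal A.family

theorem exists_mem_below (I : A.RoundedIdeal) {F : A.family} (hF : F ∈ I) :
    ∃ G ∈ I, A.Below F G := by
  obtain ⟨H, hH, h, -⟩ := I.directed hF hF
  exact ⟨H, hH, h⟩

/-- The rounded ideal of all members of the family below a given one. -/
def principal (F : A.family) : A.RoundedIdeal where
  carrier := {G | A.Below G F}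
  nonempty := exists_below F
  lower h h' := Below.trans h' h
  directed h h' := by
    obtain ⟨H, h₁, h₂, h₃⟩ := exists_below_of_below h h'
    exact ⟨H, h₃, h₁, h₂⟩

theorem principal_mono {F G : A.family} (h : A.Below F G) : principal F ≤ principal G :=
  fun _ h' => Below.trans h' h

theorem principal_le {I : A.RoundedIdeal} {F : A.family} (h : F ∈ I) : principal F ≤ I :=
  fun _ h' => I.lower h h'

/-- The union of a directed set of rounded ideals. -/
def directedUnion (S : Set A.RoundedIdeal) (hS : IsDirectedSet S) : A.RoundedIdeal where
  carrier := {F | ∃ I ∈ S, F ∈ I}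
  nonempty := by
    obtain ⟨I, hI⟩ := hS.1
    obtain ⟨F, hF⟩ := I.nonempty
    exact ⟨F, I, hI, hF⟩
  lower := by
    rintro F G ⟨I, hI, hF⟩ h
    exact ⟨I, hI, I.lower hF h⟩
  directed := by
    rintro F G ⟨I, hI, hF⟩ ⟨J, hJ, hG⟩
    obtain ⟨K, hK, hIK, hJK⟩ := hS.2 I hI J hJ
    obtain ⟨H, hH, h⟩ := K.directed (hIK hF) (hJK hG)
    exact ⟨H, ⟨K, hK, hH⟩, h⟩

theorem isLUB_directedUnion (S : Set A.RoundedIdeal) (hS : IsDirectedSet S) :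
    IsLUB S (directedUnion S hS) := by
  refine ⟨fun I hI F hF => ⟨I, hI, hF⟩, fun J hJ F => ?_⟩
  rintro ⟨I, hI, hF⟩
  exact hJ hI hF

/-- Directed suprema are unions; the continuity and approximation arguments for ideals rest on this.
-/
theorem mem_iff_of_isLUB {S : Set A.RoundedIdeal} {I : A.RoundedIdeal} (hS : IsDirectedSet S)
    (hI : IsLUB S I) {F : A.family} : F ∈ I ↔ ∃ J ∈ S, F ∈ J := by
  rw [hI.unique (isLUB_directedUnion S hS)]
  rfl

theorem isLUB_of_mem_iff {S : Set A.RoundedIdeal} {I : A.RoundedIdeal}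
    (h : ∀ F, F ∈ I ↔ ∃ J ∈ S, F ∈ J) : IsLUB S I := by
  refine ⟨fun J hJ F hF => (h F).2 ⟨J, hJ, hF⟩, fun K hK F hF => ?_⟩
  obtain ⟨J, hJ, hF⟩ := (h F).1 hF
  exact hK hJ hF

theorem isDirectedSet_image_principal (I : A.RoundedIdeal) :
    IsDirectedSet (principal '' (I : Set A.family)) := by
  refine ⟨Set.Nonempty.image _ I.nonempty, ?_⟩
  rintro _ ⟨F, hF, rfl⟩ _ ⟨G, hG, rfl⟩
  obtain ⟨H, hH, hFH, hGH⟩ := I.directed hF hG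
  exact ⟨_, ⟨H, hH, rfl⟩, principal_mono hFH, principal_mono hGH⟩

theorem isLUB_image_principal (I : A.RoundedIdeal) :
    IsLUB (principal '' (I : Set A.family)) I := by
  refine isLUB_of_mem_iff fun F => ⟨fun hF => ?_, ?_⟩
  -- `Below` need not be reflexive, so `F` may be missing from `principal F`; roundedness supplies a
  -- larger `G`.
  · obtain ⟨G, hG, h⟩ := I.exists_mem_below hF
    exact ⟨_, ⟨G, hG, rfl⟩, h⟩
  · rintro ⟨_, ⟨G, hG, rfl⟩, h⟩
    exact I.lower hG h

theorem approximates_principal {I : A.RoundedIdeal} {F : A.family} (hF : F ∈ I) :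
    Approximates (principal F) I := by
  intro S J hS hJ hIJ
  obtain ⟨K, hK, hFK⟩ := (mem_iff_of_isLUB hS hJ).1 (hIJ hF)
  exact ⟨K, hK, principal_le hFK⟩

theorem isBasis_range_principal : IsBasis (Set.range (principal (A := A))) := by
  refine fun I => ⟨_, ?_, I.isDirectedSet_image_principal, I.isLUB_image_principal⟩
  rintro _ ⟨F, hF, rfl⟩
  exact ⟨⟨F, rfl⟩, approximates_principal hF⟩

/-- Every ideal is the directed union of the principal ideals of its members, and `f` preserves that
union. -/
theorem mem_apply_iff {f : A.RoundedIdeal → B.RoundedIdeal} (hf : ScottContinuous f)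
    {I : A.RoundedIdeal} {G : B.family} : G ∈ f I ↔ ∃ F ∈ I, G ∈ f (principal F) := by
  have hd := I.isDirectedSet_image_principal
  have hl := hf hd.1 hd.2 I.isLUB_image_principal
  have hd' : DirectedOn (· ≤ ·) (f '' (principal '' (I : Set A.family))) :=
    directedOn_image.2 (hd.2.mono' fun _ _ _ _ h => hf.monotone h)
  rw [mem_iff_of_isLUB ⟨hd.1.image f, hd'⟩ hl]
  simp

/-- The image of a rounded ideal under a CF-approximable relation. -/
def map (Δ : Hom A B) (I : A.RoundedIdeal) : B.RoundedIdeal where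
  carrier := {G | ∃ F ∈ I, Δ.rel F G}
  nonempty := by
    obtain ⟨F, hF⟩ := I.nonempty
    obtain ⟨G, hG⟩ := Δ.total F
    exact ⟨G, F, hF, hG⟩
  lower := by
    rintro G G' ⟨F, hF, h⟩ h'
    exact ⟨F, hF, Δ.mono_right _ _ _ h h'⟩
  directed := by
    rintro G G' ⟨F, hF, h⟩ ⟨F', hF', h'⟩
    obtain ⟨E, hE, hFE, hFE'⟩ := I.directed hF hF'
    obtain ⟨H, hH, hEH⟩ := Δ.directed E G G'
      (Δ.mono_left _ _ _ hFE h) (Δ.mono_left _ _ _ hFE' h')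
    exact ⟨H, ⟨E, hE, hEH⟩, Set.subset_union_left.trans hH, Set.subset_union_right.trans hH⟩

theorem mem_map {Δ : Hom A B} {I : A.RoundedIdeal} {G : B.family} :
    G ∈ map Δ I ↔ ∃ F ∈ I, Δ.rel F G := Iff.rfl

theorem map_scottContinuous (Δ : Hom A B) : ScottContinuous (map Δ) := by
  intro S hS hd I hI
  refine isLUB_of_mem_iff fun G => ?_
  simp only [mem_map, mem_iff_of_isLUB ⟨hS, hd⟩ hI, Set.exists_mem_image]
  tauto

/-- Recovers `Δ` from its action on ideals, hence faithfulness. Interpolation is needed to replace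
`F` by some `F₁` below it. -/
theorem mem_map_principal {Δ : Hom A B} {F : A.family} {G : B.family} :
    G ∈ map Δ (principal F) ↔ Δ.rel F G := by
  constructor
  · rintro ⟨F', hF', h⟩
    exact Δ.mono_left _ _ _ hF' h
  · intro h
    obtain ⟨F₁, G₁, hF, hG, h₁⟩ := Δ.interpolate _ _ h
    exact ⟨F₁, hF, Δ.mono_right _ _ _ h₁ hG⟩

theorem map_id (I : A.RoundedIdeal) : map (Hom.id A) I = I := by
  refine SetLike.ext fun G => ⟨?_, fun hG => I.exists_mem_below hG⟩
  rintro ⟨F, hF, h⟩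
  exact I.lower hF h

theorem map_comp (Δ : Hom A B) (Ω : Hom B C) (I : A.RoundedIdeal) :
    map (Δ.comp Ω) I = map Ω (map Δ I) := by
  refine SetLike.ext fun G => ⟨?_, ?_⟩
  · rintro ⟨F, hF, E, h, h'⟩
    exact ⟨E, ⟨F, hF, h⟩, h'⟩
  · rintro ⟨E, ⟨F, hF, h⟩, h'⟩
    exact ⟨F, hF, E, h, h'⟩

end RoundedIdeal

/-! ### The rounded ideal functor is full and faithful. -/

open RoundedIdeal

/-- The CF-approximable relation induced by a Scott continuous function between the posets of
rounded ideals. -/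
def Hom.ofScottContinuous (f : A.RoundedIdeal → B.RoundedIdeal) (hf : ScottContinuous f) :
    Hom A B where
  rel F G := G ∈ f (principal F)
  total F := (f (principal F)).nonempty
  mono_left F F' G h hG := hf.monotone (principal_mono h) hG
  mono_right F G G' hG h := (f (principal F)).lower hG h
  interpolate F G h := by
    obtain ⟨F₁, hF, hG⟩ := (mem_apply_iff hf).1 h
    obtain ⟨G₁, hG₁, hGG₁⟩ := (f (principal F₁)).exists_mem_below hG
    exact ⟨F₁, G₁, hF, hGG₁, hG₁⟩
  directed F G G' h h' := by
    obtain ⟨H, hH, hG, hG'⟩ := (f (principal F)).directed h h'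
    exact ⟨H, Set.union_subset hG hG', hH⟩

theorem map_ofScottContinuous (f : A.RoundedIdeal → B.RoundedIdeal) (hf : ScottContinuous f) :
    RoundedIdeal.map (Hom.ofScottContinuous f hf) = f :=
  funext fun _ => SetLike.ext fun _ => (mem_apply_iff hf).symm

/-- The domain of rounded ideals of a CF-approximation space. -/
def toDom (A : CFApproxSpace.{u}) : Dom.{u} where
  carrier := A.RoundedIdeal
  directedComplete S hS := ⟨_, isLUB_directedUnion S hS⟩
  exists_basis := ⟨_, isBasis_range_principal⟩

/-- The functor from **CFA** to **DOM** given by rounded ideals. -/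
def roundedIdealFunctor : CFApproxSpace.{u} ⥤ Dom.{u} where
  obj := toDom
  map {A B} Δ := (⟨RoundedIdeal.map Δ, map_scottContinuous Δ⟩ : Dom.Hom A.toDom B.toDom)
  map_id _ := Dom.Hom.ext (funext RoundedIdeal.map_id)
  map_comp Δ Ω := Dom.Hom.ext (funext (RoundedIdeal.map_comp Δ Ω))

instance : roundedIdealFunctor.{u}.Faithful where
  map_injective {A B Δ Ω} h := by
    have h' : RoundedIdeal.map Δ = RoundedIdeal.map Ω := congrArg Dom.Hom.toFun h
    refine Hom.ext (funext₂ fun F G => propext ?_)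
    rw [← mem_map_principal, h', mem_map_principal]

instance : roundedIdealFunctor.{u}.Full where
  map_surjective f :=
    ⟨Hom.ofScottContinuous f.toFun f.scottContinuous,
      Dom.Hom.ext (map_ofScottContinuous f.toFun f.scottContinuous)⟩

/-! ### Every domain arises from a CF-approximation space. -/

theorem mem_upperApprox_singleton {U : Type u} {Θ : U → U → Prop} {x y : U} :
    x ∈ upperApprox Θ (({y} : Finset U) : Set U) ↔ Θ x y := by
  simp [upperApprox, Set.Nonempty]

/-- The CF-approximation space of a domain: the approximation relation with all singletons. -/
def ofDom (D : Dom.{u}) : CFApproxSpace.{u} where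
  carrier := D.carrier
  rel := Approximates
  rel_trans _ _ _ h h' := h.mono le_rfl h'.le
  family := Set.range fun x => {x}
  cf := by
    rintro _ ⟨x, rfl⟩ K hK
    obtain ⟨B, hB⟩ := D.exists_basis
    obtain ⟨y, hy, hKy⟩ := (hB.isDirectedSet_approximates x).exists_finset_le K
      fun k hk => mem_upperApprox_singleton.1 (hK hk)
    -- The bound `y` only dominates `K` in the order; interpolating `z` turns this into
    -- approximation.
    obtain ⟨z, hyz, hzx⟩ := hB.exists_between hy
    refine ⟨{z}, ⟨z, rfl⟩, fun k hk => mem_upperApprox_singleton.2 (hyz.mono (hKy k hk) le_rfl), ?_⟩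
    rw [Finset.coe_singleton, Set.singleton_subset_iff]
    exact mem_upperApprox_singleton.2 hzx

namespace ofDom

variable {D : Dom.{u}}

/-- The singleton of a point as a member of the family of `ofDom D`. -/
def single (x : D.carrier) : (ofDom D).family := ⟨{x}, x, rfl⟩

theorem exists_eq_single (F : (ofDom D).family) : ∃ x, F = single x := by
  obtain ⟨_, x, rfl⟩ := F
  exact ⟨x, rfl⟩

theorem below_single {x y : D.carrier} :
    (ofDom D).Below (single x) (single y) ↔ Approximates x y := by
  refine ⟨fun h => mem_upperApprox_singleton.1 (h (Finset.mem_singleton_self x)),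
    fun h z hz => ?_⟩
  obtain rfl := Finset.mem_singleton.1 hz
  exact mem_upperApprox_singleton.2 h

theorem mem_principal_single {x y : D.carrier} :
    single x ∈ principal (single y) ↔ Approximates x y := below_single

theorem principal_single_le_iff {x y : D.carrier} :
    principal (single x) ≤ principal (single y) ↔ x ≤ y := by
  obtain ⟨B, hB⟩ := D.exists_basis
  constructor
  · exact fun h => (hB.isLUB_approximates x).2 fun z hz =>
      (mem_principal_single.1 (h (mem_principal_single.2 hz))).le
  · intro h F hF
    obtain ⟨z, rfl⟩ := exists_eq_single F
    exact mem_principal_single.2 ((mem_principal_single.1 hF).mono le_rfl h)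

/-- The witness is the supremum of the points whose singletons lie in `I`. Roundedness upgrades `≤`
to `≪` in both inclusions. -/
theorem exists_principal_single_eq (I : (ofDom D).RoundedIdeal) :
    ∃ x, principal (single x) = I := by
  have hd : IsDirectedSet {y : D.carrier | single y ∈ I} := by
    constructor
    · obtain ⟨F, hF⟩ := I.nonempty
      obtain ⟨y, rfl⟩ := exists_eq_single F
      exact ⟨y, hF⟩
    · intro y hy z hz
      obtain ⟨H, hH, hyH, hzH⟩ := I.directed hy hz
      obtain ⟨w, rfl⟩ := exists_eq_single H
      exact ⟨w, hH, (below_single.1 hyH).le, (below_single.1 hzH).le⟩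
  obtain ⟨x, hx⟩ := D.directedComplete _ hd
  refine ⟨x, SetLike.ext fun F => ?_⟩
  obtain ⟨y, rfl⟩ := exists_eq_single F
  have hround : ∀ {z : D.carrier}, single z ∈ I → ∃ w, single w ∈ I ∧ Approximates z w := by
    intro z hz
    obtain ⟨H, hH, hzH⟩ := I.exists_mem_below hz
    obtain ⟨w, rfl⟩ := exists_eq_single H
    exact ⟨w, hH, below_single.1 hzH⟩
  rw [mem_principal_single]
  constructor
  · intro h
    obtain ⟨z, hz, hyz⟩ := h _ x hd hx le_rfl
    obtain ⟨w, hw, hzw⟩ := hround hz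
    exact I.lower hw (below_single.2 (hzw.mono hyz le_rfl))
  · intro h
    obtain ⟨w, hw, hyw⟩ := hround h
    exact hyw.mono le_rfl (hx.1 hw)

/-- A domain is order isomorphic to the rounded ideals of its CF-approximation space. -/
noncomputable def orderIso (D : Dom.{u}) : D.carrier ≃o (ofDom D).RoundedIdeal :=
  RelIso.ofSurjective
    (OrderEmbedding.ofMapLEIff (fun x => principal (single x)) fun _ _ => principal_single_le_iff)
    exists_principal_single_eq

end ofDom

instance : roundedIdealFunctor.{u}.EssSurj where
  mem_essImage D :=
    ⟨ofDom D, ⟨(Dom.isoOfOrderIso (E := (ofDom D).toDom) (ofDom.orderIso D)).symm⟩⟩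

instance : roundedIdealFunctor.{u}.IsEquivalence where

end CFApproxSpace

end RoughSet

/-- The category of CF-approximation spaces and CF-approximable relations is equivalent to the
category of domains and Scott continuous functions. -/
theorem mainTheorem4 :
    Nonempty (RoughSet.CFApproxSpace.{u} ≌ DomainTheory.Dom.{u}) :=
  ⟨RoughSet.CFApproxSpace.roundedIdealFunctor.asEquivalence⟩
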